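/- **Theorem 4.2.** Let $q$ be a prime power and let $m,m_1,m_2$ be positive integers with $m_1\mid m$, $m_2\mid m$, $m_2>1$, $\gcd(m_1,m_2)=2$ and $(m_1,m_2)\neq(2,2)$. For $i=1,2$ let $\operatorname{Tr}_{q^{m_i}/q}:\mathbb F_{q^{m_i}}\to\mathbb F_q$ be the trace and $\mathrm N_{q^m/q^{m_i}}:\mathbb F_{q^m}\to\mathbb F_{q^{m_i}}$ the norm. Let $$D=\{x\in\mathbb F_{q^m}^*:\operatorname{Tr}_{q^{m_2}/q}(\mathrm N_{q^m/q^{m_2}}(x))=0\}=\{d_1,\dots,d_n\},\qquad n=|D|,$$ and let $$\mathcal C_D=\left\{\left(\operatorname{Tr}_{q^{m_1}/q}(x\,\mathrm N_{q^m/q^{m_1}}(d_1)),\dots,\operatorname{Tr}_{q^{m_1}/q}(x\,\mathrm N_{q^m/q^{m_1}}(d_n))\right):x\in\mathbb F_{q^{m_1}}\right\}\subseteq\mathbb F_q^n .$$ Then $\mathcal C_D$ is a linear code over $\mathbb F_q$ of length $$n=\frac{q^m-1}{q^{m_2}-1}\,(q^{m_2-1}-1)$$ and dimension $m_1$, and it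 has exactly two nonzero Hamming weights $w_1\ne w_2$. They are $$w_1=\frac{q^{m_1-1}(q-1)(q^m-1)\left(q^{m_2-1}-1-(-1)^{\frac{m_1+m_2}{2}}(q-1)q^{\frac{m_2-m_1}{2}}\right)}{(q^{m_1}-1)(q^{m_2}-1)},$$ $$w_2=\frac{q^{m_1-1}(q-1)(q^m-1)\left(q^{m_2-1}-1-(-1)^{\frac{m_1+m_2}{2}+1}(q-1)q^{\frac{m_2-m_1}{2}-1}\right)}{(q^{m_1}-1)(q^{m_2}-1)},$$ and the numbers of codewords of weight $w_1$ and $w_2$ are $$\frac{q^{m_1}-1}{q+1}\quad\text{and}\quad\frac{q(q^{m_1}-1)}{q+1},$$ respectively. That is, with $A_i$ the number of codewords of Hamming weight $i$, the weight enumerator is $$\sum_{i=0}^n A_i z^i=1+\frac{q^{m_1}-1}{q+1}\,z^{w_1}+\frac{q(q^{m_1}-1)}{q+1}\,z^{w_2}.$$ -/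

import Mathlib

open Polynomial

namespace TraceNormCode

/-- For a tower of finite fields `F ⊆ E₂ ⊆ L` and `a : F`, the defining set
`D = {x ∈ L* : Tr_{E₂/F}(N_{L/E₂}(x)) + a = 0}`. -/
def definingSet {F : Type*} (E₂ L : Type*) [Field F] [Field E₂] [Field L]
    [Algebra F E₂] [Algebra E₂ L] (a : F) : Set L :=
  {x : L | x ≠ 0 ∧ Algebra.trace F E₂ (Algebra.norm E₂ x) + a = 0}

/-- The encoding map sending `x : E₁` to the word
`(Tr_{E₁/F}(x N_{L/E₁}(d₁)), …, Tr_{E₁/F}(x N_{L/E₁}(dₙ)))`. -/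
noncomputable def codeword (F E₁ : Type*) {L : Type*} [Field F] [Field E₁] [Field L]
    [Algebra F E₁] [Algebra E₁ L] {n : ℕ} (d : Fin n → L) : E₁ →ₗ[F] (Fin n → F) where
  toFun x := fun i => Algebra.trace F E₁ (x * Algebra.norm E₁ (d i))
  map_add' x y := by
    funext i
    simp [add_mul]
  map_smul' c x := by
    funext i
    simp

/-- The linear code `{(Tr_{E₁/F}(x N_{L/E₁}(dᵢ)))ᵢ : x ∈ E₁}` of length `n` over `F`
attached to the list `d₁, …, dₙ` of elements of `L`. -/
noncomputable def code (F E₁ : Type*) {L : Type*} [Field F] [Field E₁] [Field L]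
    [Algebra F E₁] [Algebra E₁ L] {n : ℕ} (d : Fin n → L) : Submodule F (Fin n → F) :=
  LinearMap.range (codeword F E₁ d)

open Classical in
/-- `A_i`: the number of codewords of Hamming weight `i` in a linear code. -/
noncomputable def weightFrequency {F : Type*} [Field F] {n : ℕ}
    (C : Submodule F (Fin n → F)) (i : ℕ) : ℕ :=
  Nat.card {c : Fin n → F // c ∈ C ∧ hammingNorm c = i}

/-- The weight enumerator `A_0 + A_1 z + ⋯ + A_n z^n`. -/
noncomputable def weightEnumerator {F : Type*} [Field F] {n : ℕ}
    (C : Submodule F (Fin n → F)) : ℕ[X] :=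
  ∑ i ∈ Finset.range (n + 1), monomial i (weightFrequency C i)

/-- A code is `t`-weight if exactly `t` of `A_1, …, A_n` are nonzero. -/
def IsWeight {F : Type*} [Field F] {n : ℕ} (t : ℕ) (C : Submodule F (Fin n → F)) : Prop :=
  ((Finset.Icc 1 n).filter fun j => weightFrequency C j ≠ 0).card = t

end TraceNormCode

/-! Write m_i = 2 s_i and J_i = (q^{m_i} - 1)/(q + 1). The weight of the word of x is n minus the
number M of d in D with Tr₁(x N₁(d)) = 0, so everything rests on computing M.

The condition at `E_i` is invariant under H_i, the elements of L* whose norm to `E_i` lies in F.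
Since y^{A_i} lies in H_i for A_i = (q^{m_i} - 1)/(q - 1), and gcd(A₁, A₂) = q + 1, every (q+1)-th
power lies in H₁H₂. Hence the two conditions are independent on each coset of the (q+1)-th powers
(`sum_card_mul_card_eq_of_invariant`), and M is a sum of products of one-field counts.

On a coset, each count is the number of nonzero zeros of a Hermitian form y ↦ Tr(a y^{q+1})
(`mul_hermitianCount_zero`). With N_c the number of y of value c, (N_0 - N_1)² is q^{2s} times the
size of the radical, which is q² or 1 according to whether a^J = (-1)^s; the congruence N_0 - N_1 ≡
1 mod q + 1 fixes the sign. So each count takes two values.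

The cosets with a nontrivial radical for i = 1, 2 are the solutions z of z^J = c₁ and z^J = c₂, with
J = |L*|/(q + 1). These sets coincide or are disjoint, and coincide exactly when x^{J₁} =
(-1)^{s₁+s₂}: this gives two weights, with frequencies J₁ and qJ₁. Both weights are positive, so the
encoding is injective. -/

namespace TraceNormCode

/-! ### Counting in finite groups; independence on cosets -/

section Groups

/-- The fibres of a group homomorphism all have the cardinality of its kernel. -/
theorem card_subtype_comp_hom {G H : Type*} [Group G] [Group H] (φ : G →* H) (p : H → Prop) :
    Nat.card {g : G // p (φ g)} = Nat.card φ.ker * Nat.card {h : φ.range // p h} := by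
  choose s hs using fun h : φ.range => h.2
  let e : {g : G // p (φ g)} ≃ φ.ker × {h : φ.range // p h} :=
    { toFun := fun g => (⟨(s ⟨φ g, g, rfl⟩)⁻¹ * g, by simp [MonoidHom.mem_ker, hs]⟩,
        ⟨⟨φ g, g, rfl⟩, g.2⟩)
      invFun := fun x => ⟨s x.2.1 * x.1, by
        have := x.1.2
        rw [MonoidHom.mem_ker] at this
        rw [map_mul, hs, this, mul_one]; exact x.2.2⟩
      left_inv := fun g => by simp
      right_inv := fun ⟨⟨k, hk⟩, ⟨h, hh⟩⟩ => by
        rw [MonoidHom.mem_ker] at hk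
        have : (⟨φ (s h * k), s h * k, rfl⟩ : φ.range) = h := by
          ext; simp [hs, hk]
        refine Prod.ext (Subtype.ext ?_) (Subtype.ext this)
        change (s ⟨φ (s h * k), s h * k, rfl⟩)⁻¹ * (s h * k) = k
        rw [this, inv_mul_cancel_left] }
  rw [Nat.card_congr e, Nat.card_prod]

theorem card_subtype_comp_of_surjective {G H : Type*} [Group G] [Group H] (φ : G →* H)
    (hφ : Function.Surjective φ) (p : H → Prop) :
    Nat.card {g : G // p (φ g)} = Nat.card φ.ker * Nat.card {h : H // p h} := by
  rw [card_subtype_comp_hom]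
  congr 1
  refine Nat.card_congr (Equiv.subtypeEquiv
    (Equiv.ofBijective (fun h : φ.range => (h : H))
      ⟨Subtype.val_injective, fun h => ⟨⟨h, hφ h⟩, rfl⟩⟩) fun a => Iff.rfl)

/-- In a cyclic group of order jk the j-th powers lie in the k-torsion, and both subgroups have
order k. -/
theorem mem_range_powMonoidHom_of_pow_eq_one {G : Type*} [CommGroup G] [IsCyclic G] [Finite G]
    {j k : ℕ} (hG : Nat.card G = j * k) {c : G} (hc : c ^ k = 1) :
    c ∈ (powMonoidHom j : G →* G).range := by
  have hpos : 0 < j * k := hG ▸ Nat.card_pos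
  have hj : 0 < j := Nat.pos_of_mul_pos_right hpos
  have hk : 0 < k := Nat.pos_of_mul_pos_left hpos
  have hle : (powMonoidHom j : G →* G).range ≤ (powMonoidHom k : G →* G).ker := by
    rintro _ ⟨g, rfl⟩
    rw [MonoidHom.mem_ker, powMonoidHom_apply, powMonoidHom_apply, ← pow_mul, ← hG,
      pow_card_eq_one']
  have hcard : Nat.card (powMonoidHom k : G →* G).ker ≤
      Nat.card (powMonoidHom j : G →* G).range := by
    rw [IsCyclic.card_powMonoidHom_ker, IsCyclic.card_powMonoidHom_range, hG,
      Nat.gcd_mul_left_left, Nat.gcd_mul_right_left, Nat.mul_div_cancel_left _ hj]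
  rw [Subgroup.eq_of_le_of_card_ge hle hcard]
  simpa [MonoidHom.mem_ker] using hc

theorem card_pow_eq_of_isCyclic {G : Type*} [CommGroup G] [IsCyclic G] [Finite G]
    {j k : ℕ} (hG : Nat.card G = j * k) {c : G} (hc : c ^ k = 1) :
    Nat.card {z : G // z ^ j = c} = j := by
  have h := card_subtype_comp_hom (powMonoidHom j : G →* G) (· = c)
  have hmem := mem_range_powMonoidHom_of_pow_eq_one hG hc
  have h1 : Nat.card {h : (powMonoidHom j : G →* G).range // (h : G) = c} = 1 := by
    rw [Nat.card_eq_one_iff_unique]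
    exact ⟨⟨fun a b => Subtype.ext (Subtype.ext (a.2.trans b.2.symm))⟩, ⟨⟨⟨c, hmem⟩, rfl⟩⟩⟩
  rw [h1, IsCyclic.card_powMonoidHom_ker, hG, Nat.gcd_mul_right_left, mul_one] at h
  exact h

/-- If `p₁` is invariant under `H₁` and `p₂` is invariant under `H₂`, then `p₁` and `p₂` are
independent on the cosets of a subgroup (the image of `φ`) contained in `H₁ ⊔ H₂`. -/
theorem sum_card_mul_card_eq_of_invariant {G Y : Type*} [CommGroup G] [Fintype G] [Finite Y]
    (φ : Y → G) (H₁ H₂ : Subgroup G) (hφ : ∀ y, φ y ∈ H₁ ⊔ H₂) (p₁ p₂ : G → Prop)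
    (h₁ : ∀ g, ∀ h ∈ H₁, (p₁ (g * h) ↔ p₁ g)) (h₂ : ∀ g, ∀ h ∈ H₂, (p₂ (g * h) ↔ p₂ g)) :
    ∑ z : G, Nat.card {y : Y // p₁ (z * φ y)} * Nat.card {y : Y // p₂ (z * φ y)} =
      Nat.card Y ^ 2 * Nat.card {g : G // p₁ g ∧ p₂ g} := by
  classical
  have := Fintype.ofFinite Y
  have key : ∀ y y' : Y, Nat.card {z : G // p₁ (z * φ y) ∧ p₂ (z * φ y')} =
      Nat.card {g : G // p₁ g ∧ p₂ g} := by
    intro y y'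
    -- With φ(y)⁻¹ φ(y') = ab, the substitution g = z φ(y) a turns z φ(y) into g up to H₁ and z
    -- φ(y') into gb, so both conditions are read at the same g.
    obtain ⟨a, ha, b, hb, hab⟩ := Subgroup.mem_sup.1 ((H₁ ⊔ H₂).mul_mem
      ((H₁ ⊔ H₂).inv_mem (hφ y)) (hφ y'))
    refine Nat.card_congr (Equiv.subtypeEquiv (Equiv.mulRight (φ y * a)) fun z => ?_)
    have e1 : z * (φ y * a) = z * φ y * a := by rw [mul_assoc]
    have e2 : z * φ y' = z * (φ y * a) * b := by
      rw [mul_assoc z, mul_assoc (φ y), hab, mul_inv_cancel_left]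
    rw [Equiv.coe_mulRight, e2, h₂ _ b hb]
    dsimp only
    rw [← h₁ (z * φ y) a ha, e1]
  calc _ = ∑ z : G, Nat.card {x : Y × Y // p₁ (z * φ x.1) ∧ p₂ (z * φ x.2)} := by
        refine Finset.sum_congr rfl fun z _ => ?_
        rw [← Nat.card_prod]
        exact Nat.card_congr (Equiv.subtypeProdEquivProd (p := fun y => p₁ (z * φ y))
          (q := fun y => p₂ (z * φ y))).symm
    _ = ∑ x : Y × Y, Nat.card {z : G // p₁ (z * φ x.1) ∧ p₂ (z * φ x.2)} := by
        simp only [Nat.card_eq_fintype_card, Fintype.card_subtype, Finset.card_filter]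
        rw [Finset.sum_comm]
    _ = _ := by
        simp_rw [key]
        simp [sq]

end Groups

/-! ### Zeros of the Hermitian form Tr(a y^{q+1}) -/

section HermitianForm

theorem card_subtype_eq_card_units_add_one {E : Type*} [Field E] [Finite E] (p : E → Prop)
    (h0 : p 0) : Nat.card {y : E // p y} = Nat.card {y : Eˣ // p y} + 1 := by
  classical
  have e : {y : E // p y} ≃ Option {y : Eˣ // p y} :=
    { toFun := fun y => if h : y.1 = 0 then none else some ⟨Units.mk0 y.1 h, y.2⟩
      invFun := fun y => y.elim ⟨0, h0⟩ fun y => ⟨y.1, y.2⟩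
      left_inv := fun ⟨y, hy⟩ => by
        by_cases h : y = 0
        · subst h; simp
        · simp [h]
      right_inv := fun y => by
        cases y with
        | none => simp
        | some y => simp }
  rw [Nat.card_congr e, Finite.card_option]

theorem card_subtype_eq_card_units {E : Type*} [Field E] [Finite E] (p : E → Prop)
    (h0 : ¬ p 0) : Nat.card {y : E // p y} = Nat.card {y : Eˣ // p y} :=
  Nat.card_congr
    { toFun := fun y => ⟨Units.mk0 y.1 fun h => h0 (h ▸ y.2), y.2⟩
      invFun := fun y => ⟨y.1, y.2⟩
      left_inv := fun y => by simp
      right_inv := fun y => by simp }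

/-- The orders of the multiplicative groups of `𝔽_{q²} ⊆ 𝔽_{q^{2s}}`. -/
theorem exists_sq_sub_one_mul_eq {q s J : ℕ} (hq : 1 < q) (hJ : (q + 1) * J = q ^ (2 * s) - 1) :
    ∃ I, (q ^ 2 - 1) * I = q ^ (2 * s) - 1 ∧ J = (q - 1) * I ∧
      I = ∑ j ∈ Finset.range s, q ^ (2 * j) := by
  have hI : (q ^ 2 - 1) * ∑ j ∈ Finset.range s, q ^ (2 * j) = q ^ (2 * s) - 1 := by
    have := Nat.geomSum_eq (show 2 ≤ q ^ 2 by nlinarith) s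
    simp_rw [← pow_mul] at this
    rw [this]
    refine Nat.mul_div_cancel' ?_
    rw [pow_mul]
    simpa using Nat.sub_dvd_pow_sub_pow (q ^ 2) 1 s
  refine ⟨_, hI, ?_, rfl⟩
  have h2 : q ^ 2 - 1 = (q + 1) * (q - 1) := by
    simpa using Nat.sq_sub_sq q 1
  rw [h2, ← hJ, mul_assoc] at hI
  exact (Nat.eq_of_mul_eq_mul_left (Nat.succ_pos q) hI).symm

variable {F E : Type*} [Field F] [Field E] [Algebra F E] [Finite E] {q s J : ℕ}

theorem natCard_units_eq (hq : Nat.card F = q) {m : ℕ} (hm : Module.finrank F E = m) :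
    Nat.card Eˣ = q ^ m - 1 := by
  have := Module.Finite.of_finite (R := F) (M := E)
  rw [Nat.card_units, Module.natCard_eq_pow_finrank (K := F), hq, hm]

theorem one_lt_natCard_base (E : Type*) [Field E] [Algebra F E] [Finite E] (hq : Nat.card F = q) :
    1 < q := by
  have := Finite.of_injective _ (algebraMap F E).injective
  rw [← hq]; exact Finite.one_lt_card

theorem neg_one_pow_card_pow (hq : Nat.card F = q) (k : ℕ) : (-1 : E) ^ q ^ k = -1 := by
  have := Finite.of_injective _ (algebraMap F E).injective
  have := Fintype.ofFinite F
  have h : (-1 : F) ^ q ^ k = -1 := by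
    rw [← hq, Nat.card_eq_fintype_card, FiniteField.pow_card_pow]
  simpa using congrArg (algebraMap F E) h

/-- Powers of q fix -1 in every characteristic, so the s summands contribute one factor -1 each.
This is the source of the sign (-1)^s. -/
theorem neg_one_pow_sum (hq : Nat.card F = q) :
    (-1 : E) ^ (∑ j ∈ Finset.range s, q ^ (2 * j)) = (-1) ^ s := by
  rw [← Finset.prod_pow_eq_pow_sum, Finset.prod_congr rfl fun j _ => neg_one_pow_card_pow hq _]
  simp

/-- The (q+1)-th powers in E* are the J-torsion, and J is a multiple of q - 1, so they contain F*.
Scaling y by z then multiplies the form by c. -/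
theorem exists_pow_eq_algebraMap (hq : Nat.card F = q) (hs : Module.finrank F E = 2 * s)
    (hJ : (q + 1) * J = q ^ (2 * s) - 1) {c : F} (hc : c ≠ 0) :
    ∃ z : E, z ≠ 0 ∧ z ^ (q + 1) = algebraMap F E c := by
  have hq1 := one_lt_natCard_base E hq
  have := Finite.of_injective _ (algebraMap F E).injective
  have := Fintype.ofFinite F
  obtain ⟨I, -, hI, -⟩ := exists_sq_sub_one_mul_eq hq1 hJ
  have h1 : (Units.map (algebraMap F E : F →* E) (Units.mk0 c hc)) ^ J = 1 := by
    ext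
    rw [hI, pow_mul]
    have := FiniteField.pow_card_sub_one_eq_one c hc
    rw [← Nat.card_eq_fintype_card, hq] at this
    simp [← map_pow, this]
  obtain ⟨z, hz⟩ := mem_range_powMonoidHom_of_pow_eq_one
    ((natCard_units_eq hq hs).trans hJ.symm) h1
  refine ⟨z, z.ne_zero, ?_⟩
  simpa using congrArg Units.val hz

/-- The number of vectors with a given value of the Hermitian form `y ↦ Tr(a y^{q+1})`. -/
noncomputable def hermitianCount (F : Type*) {E : Type*} [Field F] [Field E] [Algebra F E]
    (q : ℕ) (a : E) (c : F) : ℕ :=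
  Nat.card {y : E // Algebra.trace F E (a * y ^ (q + 1)) = c}

theorem hermitianCount_eq_one (hq : Nat.card F = q) (hs : Module.finrank F E = 2 * s)
    (hJ : (q + 1) * J = q ^ (2 * s) - 1) (a : E) {c : F} (hc : c ≠ 0) :
    hermitianCount F q a c = hermitianCount F q a 1 := by
  obtain ⟨z, hz0, hz⟩ := exists_pow_eq_algebraMap (E := E) hq hs hJ hc
  refine (Nat.card_congr (Equiv.subtypeEquiv (Equiv.mulLeft₀ z hz0) fun y => ?_)).symm
  have : a * (z * y) ^ (q + 1) = c • (a * y ^ (q + 1)) := by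
    rw [mul_pow, hz, Algebra.smul_def]; ring
  rw [Equiv.mulLeft₀_apply, this, map_smul, smul_eq_mul]
  constructor
  · intro h; rw [h, mul_one]
  · intro h; exact mul_left_cancel₀ hc (h.trans (mul_one c).symm)

omit [Finite E] in
theorem sum_comp_eq_sum_hermitianCount [Fintype F] [Fintype E] (a : E) {M : Type*} [CommRing M]
    (f : F → M) : ∑ y : E, f (Algebra.trace F E (a * y ^ (q + 1))) =
      ∑ c : F, hermitianCount F q a c * f c := by
  classical
  rw [← Finset.sum_fiberwise Finset.univ (fun y : E => Algebra.trace F E (a * y ^ (q + 1)))]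
  refine Finset.sum_congr rfl fun c _ => ?_
  rw [Finset.sum_congr rfl (g := fun _ => f c) fun y hy => by rw [(Finset.mem_filter.1 hy).2],
    Finset.sum_const, hermitianCount, Nat.card_eq_fintype_card, Fintype.card_subtype, nsmul_eq_mul]

theorem sum_hermitianCount_mul [Fintype F] [DecidableEq F] (hq : Nat.card F = q)
    (hs : Module.finrank F E = 2 * s) (hJ : (q + 1) * J = q ^ (2 * s) - 1) (a : E)
    {M : Type*} [CommRing M] (f : F → M) :
    ∑ c : F, hermitianCount F q a c * f c = hermitianCount F q a (0 : F) * f 0 +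
      hermitianCount F q a (1 : F) * ∑ c ∈ Finset.univ.erase 0, f c := by
  rw [← Finset.add_sum_erase Finset.univ _ (Finset.mem_univ 0), Finset.mul_sum]
  congr 1
  refine Finset.sum_congr rfl fun c hc => ?_
  rw [hermitianCount_eq_one hq hs hJ a (Finset.ne_of_mem_erase hc)]

theorem hermitianCount_zero_add (hq : Nat.card F = q) (hs : Module.finrank F E = 2 * s)
    (hJ : (q + 1) * J = q ^ (2 * s) - 1) (a : E) :
    (hermitianCount F q a (0 : F) : ℤ) + (q - 1) * hermitianCount F q a (1 : F) = q ^ (2 * s) := by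
  classical
  have := Finite.of_injective _ (algebraMap F E).injective
  have := Fintype.ofFinite F
  have := Fintype.ofFinite E
  have h := sum_comp_eq_sum_hermitianCount (q := q) a (fun _ : F => (1 : ℤ))
  have hE : Fintype.card E = q ^ (2 * s) := by
    rw [Module.card_eq_pow_finrank (K := F), hs, ← Nat.card_eq_fintype_card, hq]
  rw [sum_hermitianCount_mul hq hs hJ] at h
  have hF : Fintype.card F = q := by rw [← Nat.card_eq_fintype_card, hq]
  have hq1 := one_lt_natCard_base E hq
  simp [hE, hF, Finset.card_erase_of_mem, Nat.cast_sub hq1.le] at h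
  linarith

/-- Nonzero values are equally frequent, and a nontrivial character sums to -1 over F*. In
particular the sum is the same for all nontrivial χ. -/
theorem sum_addChar_hermitian [Fintype F] [Fintype E] (hq : Nat.card F = q)
    (hs : Module.finrank F E = 2 * s) (hJ : (q + 1) * J = q ^ (2 * s) - 1) (a : E)
    {χ : AddChar F ℂ} (hχ : χ ≠ 1) :
    ∑ y : E, χ (Algebra.trace F E (a * y ^ (q + 1))) =
      (hermitianCount F q a (0 : F) : ℂ) - hermitianCount F q a (1 : F) := by
  classical
  have h := AddChar.sum_eq_zero_of_ne_one hχ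
  rw [sum_comp_eq_sum_hermitianCount (q := q) a χ,
    sum_hermitianCount_mul hq hs hJ]
  rw [← Finset.add_sum_erase _ _ (Finset.mem_univ 0), AddChar.map_zero_eq_one] at h
  rw [AddChar.map_zero_eq_one, eq_neg_of_add_eq_zero_right h]
  ring

/-- The radical of the Hermitian form `y ↦ Tr(a y^{q+1})`. -/
def hermitianRadical (q : ℕ) (a : E) : Set E := {w | a * w + a ^ q * w ^ q ^ 2 = 0}

theorem pow_card_bijective (hq : Nat.card F = q) : Function.Bijective (fun x : E => x ^ q) := by
  have := Finite.of_injective _ (algebraMap F E).injective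
  have := Fintype.ofFinite F
  have h : ∀ x : E, FiniteField.frobeniusAlgHom F E x = x ^ q := fun x => by
    rw [FiniteField.coe_frobeniusAlgHom, ← Nat.card_eq_fintype_card, hq]
  have hinj : Function.Injective (fun x : E => x ^ q) := by
    simp_rw [← h]; exact (FiniteField.frobeniusAlgHom F E).toRingHom.injective
  exact Finite.injective_iff_bijective.1 hinj

theorem add_pow_natCard (hq : Nat.card F = q) (x y : E) : (x + y) ^ q = x ^ q + y ^ q := by
  have := Finite.of_injective _ (algebraMap F E).injective
  have := Fintype.ofFinite F
  have h : ∀ x : E, FiniteField.frobeniusAlgHom F E x = x ^ q := fun x => by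
    rw [FiniteField.coe_frobeniusAlgHom, ← Nat.card_eq_fintype_card, hq]
  simp_rw [← h, map_add]

theorem trace_pow_natCard (hq : Nat.card F = q) (x : E) :
    Algebra.trace F E (x ^ q) = Algebra.trace F E x := by
  have := Finite.of_injective _ (algebraMap F E).injective
  have := Fintype.ofFinite F
  have := Algebra.trace_eq_of_algEquiv (FiniteField.frobeniusAlgEquivOfAlgebraic F E) x
  rwa [FiniteField.coe_frobeniusAlgEquivOfAlgebraic, ← Nat.card_eq_fintype_card, hq] at this

theorem trace_eq_zero_of_mem_hermitianRadical (hq : Nat.card F = q)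
    (hs : Module.finrank F E = 2 * s) {a w : E} (hw : w ∈ hermitianRadical q a) :
    Algebra.trace F E (a * w ^ (q + 1)) = 0 := by
  have hw' : a * w + a ^ q * w ^ q ^ 2 = 0 := hw
  set t := a * w ^ (q + 1) with ht
  -- Frobenius negates t, so the trace is an alternating sum of 2s terms, which cancels.
  have htq : t ^ q = -t := by
    have : t + t ^ q = w ^ q * (a * w + a ^ q * w ^ q ^ 2) := by
      rw [ht]; ring
    rw [hw', mul_zero] at this
    exact eq_neg_of_add_eq_zero_right this
  have hneg : ∀ x : E, (-x) ^ q = -x ^ q := fun x => by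
    have := neg_one_pow_card_pow (E := E) hq 1
    rw [pow_one] at this
    rw [neg_pow, this]; ring
  have hpow : ∀ i, t ^ q ^ i = (-1) ^ i * t := by
    intro i
    induction i with
    | zero => simp
    | succ i ih =>
      rw [pow_succ, pow_mul, ih]
      rcases Nat.even_or_odd i with h | h
      · rw [h.neg_one_pow, h.add_one.neg_one_pow, one_mul, htq]; ring
      · rw [h.neg_one_pow, h.add_one.neg_one_pow, neg_one_mul, hneg, htq]; ring
  apply (algebraMap F E).injective
  rw [FiniteField.algebraMap_trace_eq_sum_pow, hs, hq, map_zero]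
  simp_rw [hpow, ← Finset.sum_mul]
  rw [neg_one_geom_sum, if_pos (even_two_mul s), zero_mul]

/-- Polarization. Frobenius invariance of the trace replaces the term a w z^q by z v with v^q = a w;
the q-th power of c = v + a w^q is the expression defining the radical. -/
theorem trace_hermitian_add (hq : Nat.card F = q) (a w : E) :
    ∃ c : E, (c = 0 ↔ w ∈ hermitianRadical q a) ∧ ∀ z : E,
      Algebra.trace F E (a * (z + w) ^ (q + 1)) = Algebra.trace F E (z * c) +
        Algebra.trace F E (a * w ^ (q + 1)) + Algebra.trace F E (a * z ^ (q + 1)) := by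
  obtain ⟨v, hv⟩ := (pow_card_bijective (E := E) hq).2 (a * w)
  dsimp only at hv
  have hq0 := (one_lt_natCard_base E hq).le
  refine ⟨v + a * w ^ q, ?_, fun z => ?_⟩
  · rw [← (pow_eq_zero_iff (n := q) (by omega)), add_pow_natCard hq, hv, mul_pow, ← pow_mul, ← sq]
    rfl
  · have : a * (z + w) ^ (q + 1) =
        (z * v) ^ q + z * (a * w ^ q) + a * w ^ (q + 1) + a * z ^ (q + 1) := by
      rw [pow_succ, add_pow_natCard hq, mul_pow, hv]; ring
    rw [this, map_add, map_add, map_add, trace_pow_natCard hq, mul_add, map_add]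

/-- The sums for χ and χ⁻¹ both equal N_0 - N_1, so their product is the square. Grouping the
product by the difference w of the two variables leaves an inner sum of a linear character, which
vanishes unless w is in the radical. -/
theorem sq_hermitianCount_sub (hq : Nat.card F = q)
    (hs : Module.finrank F E = 2 * s) (hJ : (q + 1) * J = q ^ (2 * s) - 1) (a : E) :
    ((hermitianCount F q a (0 : F) : ℤ) - hermitianCount F q a (1 : F)) ^ 2 =
      q ^ (2 * s) * Nat.card (hermitianRadical q a) := by
  classical
  have := Finite.of_injective _ (algebraMap F E).injective
  have := Fintype.ofFinite F
  have := Fintype.ofFinite E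
  obtain ⟨χ, hχ⟩ : ∃ χ : AddChar F ℂ, χ ≠ 1 := by
    obtain ⟨χ, hχ⟩ := (AddChar.exists_apply_ne_zero (a := (1 : F))).2 one_ne_zero
    exact ⟨χ, fun h => hχ (by rw [h, AddChar.one_apply])⟩
  have hχ' : χ⁻¹ ≠ 1 := inv_ne_one.2 hχ
  have hcard : Fintype.card E = q ^ (2 * s) := by
    rw [Module.card_eq_pow_finrank (K := F), hs, ← Nat.card_eq_fintype_card, hq]
  have hsum : ∀ c : E, ∑ z : E, χ (Algebra.trace F E (z * c)) =
      if c = 0 then (q : ℂ) ^ (2 * s) else 0 := by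
    intro c
    split_ifs with hc
    · simp [hc, hcard]
    · let ψ : AddChar E ℂ := χ.compAddMonoidHom
        ((Algebra.trace F E).toAddMonoidHom.comp (AddMonoidHom.mulRight c))
      refine AddChar.sum_eq_zero_of_ne_one (ψ := ψ) fun h => hχ ?_
      ext x
      obtain ⟨y, hy⟩ := Algebra.trace_surjective F E x
      have := DFunLike.congr_fun h (y / c)
      simpa [ψ, div_mul_cancel₀ _ hc, hy] using this
  have key : (∑ y : E, χ (Algebra.trace F E (a * y ^ (q + 1)))) *
      ∑ z : E, χ⁻¹ (Algebra.trace F E (a * z ^ (q + 1))) =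
      q ^ (2 * s) * Nat.card (hermitianRadical q a) := by
    calc _ = ∑ z : E, ∑ w : E, χ (Algebra.trace F E (a * (z + w) ^ (q + 1))) *
          χ⁻¹ (Algebra.trace F E (a * z ^ (q + 1))) := by
          rw [Finset.mul_sum]
          refine Finset.sum_congr rfl fun z _ => ?_
          rw [← Finset.sum_mul]
          congr 1
          exact (Equiv.sum_comp (Equiv.addLeft z)
            fun y : E => χ (Algebra.trace F E (a * y ^ (q + 1)))).symm
      _ = ∑ w : E, if w ∈ hermitianRadical q a then (q : ℂ) ^ (2 * s) else 0 := by
          rw [Finset.sum_comm]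
          refine Finset.sum_congr rfl fun w _ => ?_
          obtain ⟨c, hc, hz⟩ := trace_hermitian_add hq a w
          have : ∀ z : E, χ (Algebra.trace F E (a * (z + w) ^ (q + 1))) *
              χ⁻¹ (Algebra.trace F E (a * z ^ (q + 1))) =
              χ (Algebra.trace F E (z * c)) * χ (Algebra.trace F E (a * w ^ (q + 1))) := by
            intro z
            rw [hz, AddChar.map_add_eq_mul, AddChar.map_add_eq_mul, mul_assoc, ← AddChar.mul_apply,
              mul_inv_cancel, AddChar.one_apply, mul_one]
          simp_rw [this, ← Finset.sum_mul, hsum, hc]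
          split_ifs with hw
          · rw [trace_eq_zero_of_mem_hermitianRadical hq hs hw, AddChar.map_zero_eq_one, mul_one]
          · rw [zero_mul]
      _ = _ := by
          rw [← Finset.sum_filter, Finset.sum_const, nsmul_eq_mul, mul_comm,
            Nat.card_eq_fintype_card, Fintype.card_ofFinset]
  rw [sum_addChar_hermitian hq hs hJ a hχ, sum_addChar_hermitian hq hs hJ a hχ', ← sq] at key
  exact_mod_cast key

/-- A nonzero w is in the radical iff w^{q²-1} = -a^{1-q}. In the cyclic group E* of order (q² - 1)I
this is solvable iff the right side has I-th power 1, that is a^J = (-1)^s, and then has q² - 1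
solutions. -/
theorem card_hermitianRadical (hq : Nat.card F = q)
    (hs : Module.finrank F E = 2 * s) (hJ : (q + 1) * J = q ^ (2 * s) - 1) {a : E} (ha : a ≠ 0)
    [Decidable (a ^ J = (-1) ^ s)] :
    Nat.card (hermitianRadical q a) = if a ^ J = (-1) ^ s then q ^ 2 else 1 := by
  have hq1 := one_lt_natCard_base E hq
  obtain ⟨I, hI, hJI, hIs⟩ := exists_sq_sub_one_mul_eq hq1 hJ
  have hneg : (-1 : Eˣ) ^ I = (-1) ^ s := by
    ext; rw [hIs]; simpa using neg_one_pow_sum (E := E) hq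
  set u := Units.mk0 a ha
  have hmem : ∀ w : Eˣ, (w : E) ∈ hermitianRadical q a ↔ w ^ (q ^ 2 - 1) = -(u ^ (q - 1))⁻¹ := by
    intro w
    have e : a * (w : E) + a ^ q * (w : E) ^ q ^ 2 =
        a * w * (1 + (u ^ (q - 1) * w ^ (q ^ 2 - 1) : Eˣ)) := by
      have h1 : a ^ q = a * a ^ (q - 1) := (mul_pow_sub_one (by omega) a).symm
      have h2 : (w : E) ^ q ^ 2 = w * (w : E) ^ (q ^ 2 - 1) :=
        (mul_pow_sub_one (pow_ne_zero _ (by omega)) _).symm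
      rw [h1, h2]; simp [u]; ring
    change a * (w : E) + a ^ q * (w : E) ^ q ^ 2 = 0 ↔ _
    rw [e, mul_eq_zero, or_iff_right (mul_ne_zero ha w.ne_zero), add_comm, add_eq_zero_iff_eq_neg,
      ← mul_right_inj (u ^ (q - 1)) (b := w ^ _), mul_neg, mul_inv_cancel, Units.ext_iff]
    simp
  have hcard : Nat.card (hermitianRadical q a) =
      Nat.card {w : Eˣ // w ^ (q ^ 2 - 1) = -(u ^ (q - 1))⁻¹} + 1 := by
    have h0 : (0 : E) ∈ hermitianRadical q a := by
      simp [hermitianRadical, show q ≠ 0 by omega]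
    refine (card_subtype_eq_card_units_add_one (· ∈ hermitianRadical q a) h0).trans ?_
    simp_rw [hmem]
  have hpow : (-(u ^ (q - 1))⁻¹) ^ I = (-1) ^ s * (u ^ J)⁻¹ := by
    rw [neg_pow, inv_pow, ← pow_mul, ← hJI, hneg]
  have hau : a ^ J = (-1) ^ s ↔ u ^ J = (-1) ^ s := by
    rw [Units.ext_iff]; simp [u]
  rw [hcard]
  split_ifs with h
  · rw [hau] at h
    rw [card_pow_eq_of_isCyclic ((natCard_units_eq hq hs).trans hI.symm)
      (by rw [hpow, h, mul_inv_cancel])]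
    have : 0 < q ^ 2 := by positivity
    omega
  · rw [Nat.add_eq_right, Nat.card_eq_zero]
    refine Or.inl ⟨fun ⟨w, hw⟩ => h (hau.2 ?_)⟩
    have := congrArg (· ^ I) hw
    rw [hpow, ← pow_mul, hI, ← natCard_units_eq hq hs, pow_card_eq_one'] at this
    exact (eq_of_mul_inv_eq_one this.symm).symm

theorem add_one_dvd_card_units_pow (hq : Nat.card F = q)
    (hs : Module.finrank F E = 2 * s) (hJ : (q + 1) * J = q ^ (2 * s) - 1) (p : E → Prop) :
    q + 1 ∣ Nat.card {y : Eˣ // p ((y : E) ^ (q + 1))} := by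
  have h := card_subtype_comp_hom (powMonoidHom (q + 1) : Eˣ →* Eˣ) (fun y => p y)
  rw [IsCyclic.card_powMonoidHom_ker, (natCard_units_eq hq hs).trans hJ.symm,
    Nat.gcd_mul_right_left] at h
  simp only [powMonoidHom_apply, Units.val_pow_eq_pow_val] at h
  rw [h]
  exact dvd_mul_right _ _

/-- Nonzero y come in fibres of size q + 1 under y ↦ y^{q+1}; only y = 0, counted in N_0, is left
over. -/
theorem add_one_dvd_hermitianCount (hq : Nat.card F = q)
    (hs : Module.finrank F E = 2 * s) (hJ : (q + 1) * J = q ^ (2 * s) - 1) (a : E) :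
    ((q : ℤ) + 1) ∣ (hermitianCount F q a (0 : F) : ℤ) - hermitianCount F q a (1 : F) - 1 := by
  have h0 := card_subtype_eq_card_units_add_one
    (fun y : E => Algebra.trace F E (a * y ^ (q + 1)) = 0) (by simp)
  have h1 := card_subtype_eq_card_units
    (fun y : E => Algebra.trace F E (a * y ^ (q + 1)) = 1) (by simp)
  have d0 := add_one_dvd_card_units_pow hq hs hJ fun y => Algebra.trace F E (a * y) = 0
  have d1 := add_one_dvd_card_units_pow hq hs hJ fun y => Algebra.trace F E (a * y) = 1
  rw [hermitianCount, hermitianCount, h0, h1]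
  have h := dvd_sub (Int.natCast_dvd_natCast.2 d0) (Int.natCast_dvd_natCast.2 d1)
  push_cast at h ⊢
  rwa [add_sub_right_comm, add_sub_cancel_right]

/-- Since -q ≡ 1 mod q + 1, the root (-q)^k has the right residue; the opposite root would force q +
1 to divide 2. -/
theorem eq_neg_pow_of_sq_eq {q k : ℕ} (hq : 1 < q) {D : ℤ} (hsq : D ^ 2 = ((q : ℤ) ^ k) ^ 2)
    (hd : ((q : ℤ) + 1) ∣ D - 1) : D = (-(q : ℤ)) ^ k := by
  have hD : D = (-(q : ℤ)) ^ k ∨ D = -(-(q : ℤ)) ^ k := by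
    rw [← sq_eq_sq_iff_eq_or_eq_neg, hsq, ← pow_mul, ← pow_mul, mul_comm k 2, pow_mul, pow_mul,
      neg_sq]
  refine hD.resolve_right fun h => ?_
  have h1 : ((q : ℤ) + 1) ∣ (-(q : ℤ)) ^ k - 1 := by
    refine dvd_trans ⟨-1, by ring⟩ (sub_one_dvd_pow_sub_one (-(q : ℤ)) k)
  have h2 : ((q : ℤ) + 1) ∣ 2 := by
    have h2 := dvd_neg.2 (dvd_add hd h1)
    rwa [h, show -(-(-(q : ℤ)) ^ k - 1 + ((-(q : ℤ)) ^ k - 1)) = 2 by ring] at h2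
  have := Int.le_of_dvd (by norm_num) h2
  omega

/-- The number of isotropic vectors of the Hermitian form `y ↦ Tr(a y^{q+1})`. -/
theorem mul_hermitianCount_zero (hq : Nat.card F = q)
    (hs : Module.finrank F E = 2 * s) (hJ : (q + 1) * J = q ^ (2 * s) - 1) {a : E} (ha : a ≠ 0)
    [Decidable (a ^ J = (-1) ^ s)] :
    (q : ℤ) * hermitianCount F q a (0 : F) = q ^ (2 * s) + (q - 1) * (-1) ^ s *
      if a ^ J = (-1) ^ s then -(q : ℤ) ^ (s + 1) else q ^ s := by
  have hq1 := one_lt_natCard_base E hq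
  have hadd := hermitianCount_zero_add hq hs hJ a
  have hsq := sq_hermitianCount_sub hq hs hJ a
  have hd := add_one_dvd_hermitianCount hq hs hJ a
  rw [card_hermitianRadical hq hs hJ ha] at hsq
  -- Eliminates N_1 between N_0 - N_1 = D and N_0 + (q - 1) N_1 = q^{2s}.
  have hlin : ∀ D : ℤ, (hermitianCount F q a (0 : F) : ℤ) - hermitianCount F q a (1 : F) = D →
      (q : ℤ) * hermitianCount F q a (0 : F) = q ^ (2 * s) + (q - 1) * D := by
    rintro D rfl; rw [← hadd]; ring
  split_ifs at hsq ⊢ with h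
  · rw [hlin _ (eq_neg_pow_of_sq_eq (k := s + 1) hq1 (by rw [hsq]; push_cast; ring) hd), neg_pow]
    ring
  · rw [hlin _ (eq_neg_pow_of_sq_eq (k := s) hq1 (by rw [hsq]; push_cast; ring) hd), neg_pow]
    ring

end HermitianForm

/-! ### Norm fibres and pullback of the counts to L* -/

section NormFibres

variable {F E L : Type*} [Field F] [Field E] [Field L] [Finite L] [Algebra F E] [Algebra E L]
  {q s J : ℕ}

/-- The norm `L* → E*`. -/
noncomputable abbrev unitsNorm (E L : Type*) [Field E] [Field L] [Algebra E L] : Lˣ →* Eˣ :=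
  Units.map (Algebra.norm E)

theorem card_units_norm (p : E → Prop) :
    Nat.card {y : Lˣ // p (Algebra.norm E (y : L))} =
      Nat.card (unitsNorm E L).ker * Nat.card {v : Eˣ // p v} :=
  card_subtype_comp_of_surjective (unitsNorm E L) (FiniteField.unitsMap_norm_surjective E L)
    (fun v => p v)

theorem card_ker_unitsNorm_mul :
    Nat.card (unitsNorm E L).ker * Nat.card Eˣ = Nat.card Lˣ := by
  have := card_units_norm (E := E) (L := L) fun _ => True
  rwa [Nat.card_congr (Equiv.subtypeUnivEquiv fun _ => trivial),
    Nat.card_congr (Equiv.subtypeUnivEquiv fun _ => trivial), eq_comm] at this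

theorem algebraMap_norm_pow {r j k : ℕ} (hr : r ≠ 0) (hL : Nat.card Lˣ = r * j)
    (hE : Nat.card Eˣ = r * k) (z : Lˣ) :
    algebraMap E L (Algebra.norm E (z : L)) ^ k = (z : L) ^ j := by
  have := Finite.of_injective _ (algebraMap E L).injective
  have hk := card_ker_unitsNorm_mul (E := E) (L := L)
  have hpos : 0 < Nat.card Eˣ := Nat.card_pos
  rw [FiniteField.algebraMap_norm_eq_pow, ← pow_mul, ← Nat.card_units, ← Nat.card_units,
    ← hk, Nat.mul_div_cancel _ hpos]
  congr 1
  rw [hL, hE, mul_left_comm] at hk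
  exact Nat.eq_of_mul_eq_mul_left (Nat.pos_of_ne_zero hr) hk

theorem card_ker_trace (hq : Nat.card F = q) [Finite E] {k : ℕ}
    (hk : Module.finrank F E = k + 1) :
    Nat.card {v : Eˣ // Algebra.trace F E v = 0} = q ^ k - 1 := by
  have := Finite.of_injective _ (algebraMap F E).injective
  have h1 := card_subtype_eq_card_units_add_one (fun v : E => Algebra.trace F E v = 0) (map_zero _)
  have h2 : Nat.card {v : E // Algebra.trace F E v = 0} = q ^ k := by
    change Nat.card (LinearMap.ker (Algebra.trace F E)) = _
    have h3 := LinearMap.finrank_range_add_finrank_ker (Algebra.trace F E)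
    rw [LinearMap.range_eq_top.2 (Algebra.trace_surjective F E), finrank_top,
      Module.finrank_self, hk, add_comm, Nat.add_right_cancel_iff] at h3
    rw [Module.natCard_eq_pow_finrank (K := F), hq, h3]
  omega

theorem card_units_trace_hermitian (hq : Nat.card F = q) [Finite E]
    (hs : Module.finrank F E = 2 * s) (hJ : (q + 1) * J = q ^ (2 * s) - 1) {a : E} (ha : a ≠ 0)
    [Decidable (a ^ J = (-1) ^ s)] :
    (Nat.card {v : Eˣ // Algebra.trace F E (a * (v : E) ^ (q + 1)) = 0} : ℚ) =
      ((q : ℚ) ^ (2 * s) + (q - 1) * (-1) ^ s * q ^ s) / q - 1 +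
      if a ^ J = (-1) ^ s then -(((q : ℚ) - 1) * (-1) ^ s * (q + 1) * q ^ s) / q else 0 := by
  have hq1 := one_lt_natCard_base E hq
  have hq0 : (q : ℚ) ≠ 0 := by positivity
  have h1 := card_subtype_eq_card_units_add_one
    (fun v : E => Algebra.trace F E (a * v ^ (q + 1)) = 0) (by simp)
  have h2 := mul_hermitianCount_zero hq hs hJ ha
  rw [hermitianCount, h1] at h2
  have h3 : (q : ℚ) * (Nat.card {v : Eˣ // Algebra.trace F E (a * (v : E) ^ (q + 1)) = 0} + 1) =
      q ^ (2 * s) + (q - 1) * (-1) ^ s *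
        if a ^ J = (-1) ^ s then -(q : ℚ) ^ (s + 1) else q ^ s := by
    exact_mod_cast h2
  rw [← mul_right_inj' hq0]
  split_ifs at h3 ⊢
  · field_simp; linear_combination h3
  · field_simp; linear_combination h3

theorem card_trace_norm_mul_pow (hq : Nat.card F = q) [Finite E]
    (hs : Module.finrank F E = 2 * s) (hJ : (q + 1) * J = q ^ (2 * s) - 1) {b : E} (hb : b ≠ 0)
    (z : Lˣ) [Decidable ((b * Algebra.norm E (z : L)) ^ J = (-1) ^ s)] :
    (Nat.card {y : Lˣ // Algebra.trace F E (b * Algebra.norm E ((z * y ^ (q + 1) : Lˣ) : L)) = 0}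
      : ℚ) = Nat.card (unitsNorm E L).ker *
      (((q : ℚ) ^ (2 * s) + (q - 1) * (-1) ^ s * q ^ s) / q - 1 +
      if (b * Algebra.norm E (z : L)) ^ J = (-1) ^ s
        then -(((q : ℚ) - 1) * (-1) ^ s * (q + 1) * q ^ s) / q else 0) := by
  have ha : b * Algebra.norm E (z : L) ≠ 0 :=
    mul_ne_zero hb (unitsNorm E L z).ne_zero
  rw [← card_units_trace_hermitian hq hs hJ ha, ← Nat.cast_mul,
    ← card_units_norm fun v => Algebra.trace F E (b * Algebra.norm E (z : L) * v ^ (q + 1)) = 0]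
  simp [mul_assoc]

/-- The elements of `L*` whose norm to `E` lies in `F`. -/
noncomputable def normInBase (F E L : Type*) [Field F] [Field E] [Field L] [Algebra F E]
    [Algebra E L] : Subgroup Lˣ :=
  (Units.map (algebraMap F E : F →* E)).range.comap (unitsNorm E L)

omit [Finite L] in
theorem trace_norm_mul_eq_zero_iff (b : E) (g h : Lˣ) (hh : h ∈ normInBase F E L) :
    Algebra.trace F E (b * Algebra.norm E ((g * h : Lˣ) : L)) = 0 ↔
      Algebra.trace F E (b * Algebra.norm E (g : L)) = 0 := by
  obtain ⟨c, hc⟩ := hh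
  have hc' : algebraMap F E c = Algebra.norm E (h : L) := congrArg Units.val hc
  have : b * Algebra.norm E ((g * h : Lˣ) : L) = (c : F) • (b * Algebra.norm E (g : L)) := by
    rw [Units.val_mul, map_mul, ← hc', Algebra.smul_def]; ring
  rw [this, map_smul, smul_eq_mul, mul_eq_zero, or_iff_right c.ne_zero]

omit [Finite L] in
-- The A-th power on E* is the norm to F.
theorem pow_mem_normInBase {A : ℕ} [Finite E] (hA : Nat.card Fˣ * A = Nat.card Eˣ) (y : Lˣ) :
    y ^ A ∈ normInBase F E L := by
  have := Finite.of_injective _ (algebraMap F E).injective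
  have hpos : 0 < Nat.card Fˣ := Nat.card_pos
  refine ⟨unitsNorm F E (unitsNorm E L y), ?_⟩
  rw [map_pow]
  ext
  simp [FiniteField.algebraMap_norm_eq_pow, ← Nat.card_units, ← hA, Nat.mul_div_cancel_left _ hpos]

end NormFibres

/-! ### The joint count of the two trace conditions -/

section Intersection

variable {F E₁ E₂ L : Type*} [Field F] [Field E₁] [Field E₂] [Field L] [Finite L]
  [Algebra F E₁] [Algebra F E₂] [Algebra E₁ L] [Algebra E₂ L] {q s₁ s₂ J₁ J₂ J : ℕ}

omit [Finite L] in
-- Bézout for gcd(A₁, A₂) = (q² - 1)/(q - 1) = q + 1; this is where gcd(m₁, m₂) = 2 enters.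
theorem pow_mem_sup_normInBase [Finite E₁] [Finite E₂] (hq : Nat.card F = q)
    (hs₁ : Module.finrank F E₁ = 2 * s₁) (hs₂ : Module.finrank F E₂ = 2 * s₂)
    (hs : Nat.gcd (2 * s₁) (2 * s₂) = 2) (y : Lˣ) :
    y ^ (q + 1) ∈ normInBase F E₁ L ⊔ normInBase F E₂ L := by
  have hq1 := one_lt_natCard_base E₁ hq
  have hF : Nat.card Fˣ = q - 1 := by rw [Nat.card_units, hq]
  have hdvd : ∀ m, q - 1 ∣ q ^ m - 1 := fun m => by simpa using Nat.sub_dvd_pow_sub_pow q 1 m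
  obtain ⟨A₁, hA₁⟩ := hdvd (2 * s₁)
  obtain ⟨A₂, hA₂⟩ := hdvd (2 * s₂)
  have hgcd : Nat.gcd A₁ A₂ = q + 1 := by
    have := Nat.pow_sub_one_gcd_pow_sub_one q (2 * s₁) (2 * s₂)
    rw [hs, hA₁, hA₂, Nat.gcd_mul_left, show q ^ 2 - 1 = (q - 1) * (q + 1) by
      rw [mul_comm]; simpa using Nat.sq_sub_sq q 1] at this
    exact Nat.eq_of_mul_eq_mul_left (by omega) this
  have h₁ : y ^ A₁ ∈ normInBase F E₁ L :=
    pow_mem_normInBase (by rw [hF, natCard_units_eq hq hs₁, hA₁]) y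
  have h₂ : y ^ A₂ ∈ normInBase F E₂ L :=
    pow_mem_normInBase (by rw [hF, natCard_units_eq hq hs₂, hA₂]) y
  rw [← hgcd, ← zpow_natCast, Nat.gcd_eq_gcd_ab, zpow_add, zpow_mul, zpow_mul, zpow_natCast,
    zpow_natCast]
  exact Subgroup.mul_mem_sup (Subgroup.zpow_mem _ h₁ _) (Subgroup.zpow_mem _ h₂ _)

theorem sum_indicator_mul_indicator {G : Type*} [Fintype G] (p₁ p₂ : G → Prop) [DecidablePred p₁]
    [DecidablePred p₂] (α₁ α₂ γ₁ γ₂ : ℚ) :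
    ∑ z : G, (α₁ + if p₁ z then γ₁ else 0) * (α₂ + if p₂ z then γ₂ else 0) =
      Nat.card G * (α₁ * α₂) + Nat.card {z // p₁ z} * (γ₁ * α₂) +
        Nat.card {z // p₂ z} * (α₁ * γ₂) + Nat.card {z // p₁ z ∧ p₂ z} * (γ₁ * γ₂) := by
  have : ∀ z : G, (α₁ + if p₁ z then γ₁ else 0) * (α₂ + if p₂ z then γ₂ else 0) =
      α₁ * α₂ + (if p₁ z then γ₁ * α₂ else 0) + (if p₂ z then α₁ * γ₂ else 0) +
        if p₁ z ∧ p₂ z then γ₁ * γ₂ else 0 := by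
    intro z
    by_cases h₁ : p₁ z <;> by_cases h₂ : p₂ z <;> simp [h₁, h₂] <;> ring
  simp_rw [this, Finset.sum_add_distrib]
  simp only [← Finset.sum_filter, Finset.sum_const, nsmul_eq_mul, Nat.card_eq_fintype_card,
    Fintype.card_subtype, Finset.card_univ]

/-- The number of `d ∈ L*` with `Tr_{E₁/F}(x N_{L/E₁}(d)) = 0` and `Tr_{E₂/F}(N_{L/E₂}(d)) = 0`. -/
theorem card_trace_norm_inter [Finite E₁] [Finite E₂] (hq : Nat.card F = q)
    (hs₁ : Module.finrank F E₁ = 2 * s₁) (hs₂ : Module.finrank F E₂ = 2 * s₂)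
    (hs : Nat.gcd (2 * s₁) (2 * s₂) = 2)
    (hJ₁ : (q + 1) * J₁ = q ^ (2 * s₁) - 1) (hJ₂ : (q + 1) * J₂ = q ^ (2 * s₂) - 1)
    (hJ : (q + 1) * J = Nat.card Lˣ) {x : E₁} (hx : x ≠ 0)
    [Decidable (x ^ J₁ = (-1) ^ (s₁ + s₂))] :
    (Nat.card {d : Lˣ // Algebra.trace F E₁ (x * Algebra.norm E₁ (d : L)) = 0 ∧
        Algebra.trace F E₂ (Algebra.norm E₂ (d : L)) = 0} : ℚ) =
      Nat.card Lˣ / (((q : ℚ) ^ (2 * s₁) - 1) * ((q : ℚ) ^ (2 * s₂) - 1)) *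
      (((q : ℚ) ^ (2 * s₁) / q - 1) * ((q : ℚ) ^ (2 * s₂) / q - 1) +
        (-1) ^ (s₁ + s₂) * (q - 1) ^ 2 *
          if x ^ J₁ = (-1) ^ (s₁ + s₂) then (q : ℚ) ^ (s₁ + s₂) / q
          else -(q : ℚ) ^ (s₁ + s₂) / q ^ 2) := by
  classical
  have := Fintype.ofFinite Lˣ
  have hq1 := one_lt_natCard_base E₁ hq
  have hE₁ := natCard_units_eq hq hs₁
  have hE₂ := natCard_units_eq hq hs₂
  have hcast : ∀ s, ((q ^ (2 * s) - 1 : ℕ) : ℚ) = (q : ℚ) ^ (2 * s) - 1 := fun s => by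
    rw [Nat.cast_sub (Nat.one_le_pow _ _ (by omega))]; simp
  have hk₁ : (Nat.card (unitsNorm E₁ L).ker : ℚ) * (q ^ (2 * s₁) - 1) = Nat.card Lˣ := by
    rw [← hcast, ← hE₁]; exact_mod_cast card_ker_unitsNorm_mul
  have hk₂ : (Nat.card (unitsNorm E₂ L).ker : ℚ) * (q ^ (2 * s₂) - 1) = Nat.card Lˣ := by
    rw [← hcast, ← hE₂]; exact_mod_cast card_ker_unitsNorm_mul
  have hL0 : (Nat.card Lˣ : ℚ) ≠ 0 := by exact_mod_cast Nat.card_pos.ne'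
  have h10 : (q : ℚ) ^ (2 * s₁) - 1 ≠ 0 := fun h => hL0 (by rw [← hk₁, h, mul_zero])
  have h20 : (q : ℚ) ^ (2 * s₂) - 1 ≠ 0 := fun h => hL0 (by rw [← hk₂, h, mul_zero])
  have hsum := sum_card_mul_card_eq_of_invariant (fun y : Lˣ => y ^ (q + 1))
    (normInBase F E₁ L) (normInBase F E₂ L) (pow_mem_sup_normInBase hq hs₁ hs₂ hs)
    (fun d => Algebra.trace F E₁ (x * Algebra.norm E₁ (d : L)) = 0)
    (fun d => Algebra.trace F E₂ (1 * Algebra.norm E₂ (d : L)) = 0)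
    (fun g h hh => trace_norm_mul_eq_zero_iff x g h hh)
    (fun g h hh => trace_norm_mul_eq_zero_iff 1 g h hh)
  have hsum' := congrArg (Nat.cast : ℕ → ℚ) hsum
  simp only [Nat.cast_sum, Nat.cast_mul, card_trace_norm_mul_pow hq hs₁ hJ₁ hx,
    card_trace_norm_mul_pow hq hs₂ hJ₂ one_ne_zero, Nat.cast_pow] at hsum'
  simp only [one_mul] at hsum'
  have hneg : (-1 : Lˣ) ^ (q + 1) = 1 := by
    have := neg_one_pow_card_pow (E := E₁) hq 1
    have h2 : (-1 : E₁) ^ (q + 1) = 1 := by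
      rw [pow_one] at this
      rw [pow_succ, this]; ring
    ext
    simpa using congrArg (algebraMap E₁ L) h2
  set ξ : Lˣ := Units.map (algebraMap E₁ L : E₁ →* L) (Units.mk0 x hx) with hξ
  have hξJ : (ξ ^ J₁) ^ (q + 1) = 1 := by
    rw [← pow_mul, mul_comm, hJ₁, ← hE₁, hξ, ← map_pow, pow_card_eq_one', map_one]
  set c₁ : Lˣ := (-1) ^ s₁ * (ξ ^ J₁)⁻¹ with hc₁
  set c₂ : Lˣ := (-1) ^ s₂ with hc₂
  have hc₁' : c₁ ^ (q + 1) = 1 := by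
    rw [hc₁, mul_pow, inv_pow, hξJ, pow_right_comm, hneg]; simp
  have hc₂' : c₂ ^ (q + 1) = 1 := by
    rw [hc₂, pow_right_comm, hneg, one_pow]
  -- Inside L, N₁(z)^{J₁} becomes z^J, so the two radical conditions, stated in different fields,
  -- become comparable equations in L*.
  have hp₁ : ∀ z : Lˣ, (x * Algebra.norm E₁ (z : L)) ^ J₁ = (-1) ^ s₁ ↔ z ^ J = c₁ := by
    intro z
    rw [hc₁, eq_mul_inv_iff_mul_eq, Units.ext_iff, ← (algebraMap E₁ L).injective.eq_iff]
    simp only [map_pow, map_mul, mul_pow,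
      algebraMap_norm_pow (Nat.succ_ne_zero q) hJ.symm (hE₁.trans hJ₁.symm)]
    simp [hξ, mul_comm]
  have hp₂ : ∀ z : Lˣ, (Algebra.norm E₂ (z : L)) ^ J₂ = (-1) ^ s₂ ↔ z ^ J = c₂ := by
    intro z
    rw [hc₂, Units.ext_iff, ← (algebraMap E₂ L).injective.eq_iff]
    simp only [map_pow,
      algebraMap_norm_pow (Nat.succ_ne_zero q) hJ.symm (hE₂.trans hJ₂.symm)]
    simp
  have hsame : x ^ J₁ = (-1) ^ (s₁ + s₂) ↔ c₁ = c₂ := by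
    have hn : (-1 : Lˣ) ^ s₂ * (-1) ^ s₂ = 1 := by rw [← mul_pow]; simp
    have : c₁ = c₂ ↔ ξ ^ J₁ = (-1) ^ (s₁ + s₂) := by
      rw [hc₁, hc₂, mul_inv_eq_iff_eq_mul, pow_add]
      constructor
      · intro h; rw [h, mul_right_comm, hn, one_mul]
      · intro h; rw [h, mul_left_comm, hn, mul_one]
    rw [this, Units.ext_iff, ← (algebraMap E₁ L).injective.eq_iff]
    simp [hξ]
  simp only [hp₁, hp₂] at hsum'
  have hJ' : Nat.card Lˣ = J * (q + 1) := by rw [← hJ, mul_comm]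
  -- The two equations share their left side: the solution sets are equal or disjoint.
  have hboth : Nat.card {z : Lˣ // z ^ J = c₁ ∧ z ^ J = c₂} = if c₁ = c₂ then J else 0 := by
    split_ifs with h
    · simp_rw [h, and_self]; exact card_pow_eq_of_isCyclic hJ' hc₂'
    · rw [Nat.card_eq_zero]
      exact Or.inl ⟨fun z => h (z.2.1.symm.trans z.2.2)⟩
  have hfac : ∀ k₁ k₂ : ℚ, ∀ f g : Lˣ → ℚ,
      ∑ z, k₁ * f z * (k₂ * g z) = k₁ * k₂ * ∑ z, f z * g z := by
    intro k₁ k₂ f g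
    rw [Finset.mul_sum]
    exact Finset.sum_congr rfl fun z _ => by ring
  rw [hfac, sum_indicator_mul_indicator, card_pow_eq_of_isCyclic hJ' hc₁',
    card_pow_eq_of_isCyclic hJ' hc₂', hboth] at hsum'
  have hJq : (J : ℚ) = Nat.card Lˣ / (q + 1) := by
    rw [eq_div_iff (by positivity)]; exact_mod_cast hJ'.symm
  have hk₁' : (Nat.card (unitsNorm E₁ L).ker : ℚ) = Nat.card Lˣ / (q ^ (2 * s₁) - 1) :=
    (eq_div_iff h10).2 hk₁
  have hk₂' : (Nat.card (unitsNorm E₂ L).ker : ℚ) = Nat.card Lˣ / (q ^ (2 * s₂) - 1) :=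
    (eq_div_iff h20).2 hk₂
  have hM := (eq_div_iff (pow_ne_zero 2 hL0)).2 ((mul_comm _ _).trans hsum'.symm)
  rw [hM, hk₁', hk₂', Nat.cast_ite, Nat.cast_zero, hJq]
  have hq0 : (q : ℚ) ≠ 0 := by positivity
  have hq2 : (q : ℚ) + 1 ≠ 0 := by positivity
  have he1 : ((-1 : ℚ) ^ s₁) ^ 2 = 1 := by rw [← pow_mul, mul_comm, pow_mul]; simp
  simp only [hsame]
  rw [mul_comm 2 s₁, mul_comm 2 s₂, pow_mul, pow_mul] at *
  simp only [pow_add]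
  generalize (q : ℚ) ^ s₁ = a at *
  generalize (q : ℚ) ^ s₂ = b at *
  generalize (-1 : ℚ) ^ s₁ = e at *
  generalize (-1 : ℚ) ^ s₂ = f at *
  split_ifs
  · field_simp
    ring
  · field_simp
    ring

end Intersection

/-! ### Weight distribution of a two-valued injective encoding -/

section TwoWeight

variable {F V : Type*} [Field F] [AddCommGroup V] [Module F V] {n : ℕ}

open Classical in
theorem weightFrequency_range (φ : V →ₗ[F] Fin n → F) (hφ : Function.Injective φ) (j : ℕ) :
    weightFrequency (LinearMap.range φ) j = Nat.card {x : V // hammingNorm (φ x) = j} := by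
  refine (Nat.card_congr (Equiv.ofBijective
    (fun x : {x : V // hammingNorm (φ x) = j} =>
      (⟨φ x, ⟨x, rfl⟩, x.2⟩ : {c : Fin n → F // c ∈ LinearMap.range φ ∧ hammingNorm c = j}))
    ⟨fun x y h => Subtype.ext (hφ (congrArg Subtype.val h)), ?_⟩)).symm
  rintro ⟨_, ⟨x, rfl⟩, hx⟩
  exact ⟨⟨x, hx⟩, rfl⟩

open Classical in
/-- The weight distribution of the image of an injective linear map whose nonzero values have
weight `w₁` or `w₂` according to a predicate `P`. -/
theorem weightFrequency_range_eq [Finite V] (φ : V →ₗ[F] Fin n → F) (hφ : Function.Injective φ)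
    (P : V → Prop) {w₁ w₂ : ℕ} (h₁ : ∀ x, x ≠ 0 → P x → hammingNorm (φ x) = w₁)
    (h₂ : ∀ x, x ≠ 0 → ¬ P x → hammingNorm (φ x) = w₂) (j : ℕ) :
    weightFrequency (LinearMap.range φ) j = (if j = 0 then 1 else 0) +
      (if j = w₁ then Nat.card {x : V // x ≠ 0 ∧ P x} else 0) +
      (if j = w₂ then Nat.card {x : V // x ≠ 0 ∧ ¬ P x} else 0) := by
  have := Fintype.ofFinite V
  have key : ∀ x : V, (if hammingNorm (φ x) = j then 1 else 0) =
      (if x = 0 then if j = 0 then 1 else 0 else 0) +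
      (if x ≠ 0 ∧ P x then if j = w₁ then 1 else 0 else 0) +
      (if x ≠ 0 ∧ ¬ P x then if j = w₂ then 1 else 0 else 0) := by
    intro x
    by_cases hx : x = 0
    · simp [hx, eq_comm]
    · by_cases hP : P x
      · simp [hx, hP, h₁ x hx hP, eq_comm]
      · simp [hx, hP, h₂ x hx hP, eq_comm]
  have hsum : ∀ (p : V → Prop) [DecidablePred p] (c : Prop) [Decidable c], ∑ x : V, (if p x then if c then 1 else 0 else 0) =
      if c then Nat.card {x : V // p x} else 0 := by
    intro p _ c _
    by_cases hc : c <;> simp [hc, Nat.card_eq_fintype_card, Fintype.card_subtype]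
  rw [weightFrequency_range φ hφ, Nat.card_eq_fintype_card, Fintype.card_subtype,
    Finset.card_filter, Finset.sum_congr rfl fun x _ => key x]
  simp_rw [Finset.sum_add_distrib, hsum]
  simp

open Classical in
theorem weightEnumerator_range_eq [Finite V] (φ : V →ₗ[F] Fin n → F)
    (hφ : Function.Injective φ) (P : V → Prop) {w₁ w₂ : ℕ}
    (h₁ : ∀ x, x ≠ 0 → P x → hammingNorm (φ x) = w₁)
    (h₂ : ∀ x, x ≠ 0 → ¬ P x → hammingNorm (φ x) = w₂) (hw₁ : w₁ ≤ n) (hw₂ : w₂ ≤ n) :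
    weightEnumerator (LinearMap.range φ) =
      1 + monomial w₁ (Nat.card {x : V // x ≠ 0 ∧ P x}) +
        monomial w₂ (Nat.card {x : V // x ≠ 0 ∧ ¬ P x}) := by
  ext j
  rw [weightEnumerator, finsetSum_coeff]
  simp only [coeff_monomial, coeff_add, coeff_one, Finset.sum_ite_eq', Finset.mem_range,
    weightFrequency_range_eq φ hφ P h₁ h₂, eq_comm (a := w₁), eq_comm (a := w₂)]
  split_ifs <;> omega

open Classical in
theorem isWeight_two_range [Finite V] (φ : V →ₗ[F] Fin n → F)
    (hφ : Function.Injective φ) (P : V → Prop) {w₁ w₂ : ℕ}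
    (h₁ : ∀ x, x ≠ 0 → P x → hammingNorm (φ x) = w₁)
    (h₂ : ∀ x, x ≠ 0 → ¬ P x → hammingNorm (φ x) = w₂) (hw₁ : w₁ ≤ n) (hw₂ : w₂ ≤ n)
    (hw₁0 : 0 < w₁) (hw₂0 : 0 < w₂) (hne : w₁ ≠ w₂) (hf₁ : Nat.card {x : V // x ≠ 0 ∧ P x} ≠ 0)
    (hf₂ : Nat.card {x : V // x ≠ 0 ∧ ¬ P x} ≠ 0) :
    IsWeight 2 (LinearMap.range φ) := by
  have : ((Finset.Icc 1 n).filter fun j => weightFrequency (LinearMap.range φ) j ≠ 0) =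
      {w₁, w₂} := by
    ext j
    simp only [Finset.mem_filter, Finset.mem_Icc, weightFrequency_range_eq φ hφ P h₁ h₂,
      Finset.mem_insert, Finset.mem_singleton]
    split_ifs <;> omega
  rw [IsWeight]
  convert Finset.card_pair hne

end TwoWeight

/-! ### Length, weights and frequencies of the code -/

section Weights

variable {F E₁ E₂ L : Type*} [Field F] [Field E₁] [Field E₂] [Field L]
  [Algebra F E₁] [Algebra F E₂] [Algebra E₁ L] [Algebra E₂ L] {q s₁ s₂ J₁ J₂ J n : ℕ}

theorem card_index_definingSet (d : Fin n ≃ definingSet E₂ L (0 : F)) (p : L → Prop) :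
    Nat.card {i : Fin n // p (d i)} =
      Nat.card {y : Lˣ // p y ∧ Algebra.trace F E₂ (Algebra.norm E₂ (y : L)) = 0} := by
  have e : {i : Fin n // p (d i)} ≃ {y : definingSet E₂ L (0 : F) // p y} :=
    d.subtypeEquiv fun i => Iff.rfl
  refine (Nat.card_congr e).trans (Nat.card_congr ?_)
  exact
    { toFun := fun y => ⟨Units.mk0 y.1 y.1.2.1, y.2, by simpa using y.1.2.2⟩
      invFun := fun y => ⟨⟨y.1, y.1.ne_zero, by simpa using y.2.2⟩, y.2.1⟩
      left_inv := fun y => by simp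
      right_inv := fun y => by simp }

theorem length_eq [Finite L] [Finite E₂] (hq : Nat.card F = q) {k : ℕ}
    (hk : Module.finrank F E₂ = k + 1) (d : Fin n ≃ definingSet E₂ L (0 : F)) :
    (n : ℚ) = Nat.card Lˣ / ((q : ℚ) ^ (k + 1) - 1) * ((q : ℚ) ^ k - 1) := by
  have hq1 := one_lt_natCard_base E₂ hq
  have h1 := card_index_definingSet d fun _ => True
  simp only [true_and] at h1
  rw [card_units_norm (E := E₂) fun v => Algebra.trace F E₂ v = 0, card_ker_trace hq hk,
    Nat.card_congr (Equiv.subtypeUnivEquiv fun _ => trivial), Nat.card_fin] at h1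
  have hker := card_ker_unitsNorm_mul (E := E₂) (L := L)
  rw [natCard_units_eq hq hk] at hker
  have hcast : ∀ k, ((q ^ k - 1 : ℕ) : ℚ) = (q : ℚ) ^ k - 1 := fun k => by
    rw [Nat.cast_sub (Nat.one_le_pow _ _ (by omega))]; simp
  have hne : (q : ℚ) ^ (k + 1) - 1 ≠ 0 := by
    have : (1 : ℚ) < (q : ℚ) ^ (k + 1) := one_lt_pow₀ (by exact_mod_cast hq1) (by omega)
    linarith
  rw [h1, ← hker, Nat.cast_mul, Nat.cast_mul, hcast, hcast, mul_div_cancel_right₀ _ hne]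

open Classical in
-- The weight is n minus the joint count. In the main terms, (q^{m₁} - 1) - (q^{m₁-1} - 1) =
-- q^{m₁-1}(q - 1) gives the common factor.
theorem hammingNorm_codeword [Finite L] [Finite E₁] [Finite E₂] (hq : Nat.card F = q)
    (hs₁ : Module.finrank F E₁ = 2 * s₁) (hs₂ : Module.finrank F E₂ = 2 * s₂)
    (hs : Nat.gcd (2 * s₁) (2 * s₂) = 2)
    (hJ₁ : (q + 1) * J₁ = q ^ (2 * s₁) - 1) (d : Fin n ≃ definingSet E₂ L (0 : F))
    {x : E₁} (hx : x ≠ 0) :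
    (hammingNorm (codeword F E₁ (fun i => (d i : L)) x) : ℚ) =
      Nat.card Lˣ / (((q : ℚ) ^ (2 * s₁) - 1) * ((q : ℚ) ^ (2 * s₂) - 1)) *
      ((q : ℚ) ^ (2 * s₁) / q * (q - 1)) *
      ((q : ℚ) ^ (2 * s₂) / q - 1 - (-1) ^ (s₁ + s₂) * (q - 1) *
        if x ^ J₁ = (-1) ^ (s₁ + s₂) then (q : ℚ) ^ s₂ / q ^ s₁
        else -((q : ℚ) ^ s₂ / q ^ s₁ / q)) := by
  have hq1 := one_lt_natCard_base E₁ hq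
  have hs₁0 : s₁ ≠ 0 := by
    have := Module.Finite.of_finite (R := F) (M := E₁)
    have := Module.finrank_pos (R := F) (M := E₁)
    omega
  have hs₂0 : s₂ ≠ 0 := by
    have := Module.Finite.of_finite (R := F) (M := E₂)
    have := Module.finrank_pos (R := F) (M := E₂)
    omega
  obtain ⟨J₂, hJ₂⟩ : q + 1 ∣ q ^ (2 * s₂) - 1 := by
    refine dvd_trans ⟨q - 1, by simpa using Nat.sq_sub_sq q 1⟩
      (by rw [pow_mul]; simpa using Nat.sub_dvd_pow_sub_pow (q ^ 2) 1 s₂)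
  have hJ : (q + 1) * (Nat.card (unitsNorm E₁ L).ker * J₁) = Nat.card Lˣ := by
    rw [mul_left_comm, hJ₁, ← natCard_units_eq hq hs₁, card_ker_unitsNorm_mul]
  have hM := card_trace_norm_inter hq hs₁ hs₂ hs hJ₁ hJ₂.symm hJ hx
  have hn := length_eq hq (k := 2 * s₂ - 1) (by omega) d
  rw [show 2 * s₂ - 1 + 1 = 2 * s₂ by omega] at hn
  have hsplit : Nat.card {y : Lˣ // Algebra.trace F E₁ (x * Algebra.norm E₁ (y : L)) = 0 ∧
      Algebra.trace F E₂ (Algebra.norm E₂ (y : L)) = 0} +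
      hammingNorm (codeword F E₁ (fun i => (d i : L)) x) = n := by
    rw [← card_index_definingSet d fun y => Algebra.trace F E₁ (x * Algebra.norm E₁ y) = 0,
      Nat.card_eq_fintype_card, Fintype.card_subtype]
    have := Finset.card_filter_add_card_filter_not (s := (Finset.univ : Finset (Fin n)))
      (fun i => Algebra.trace F E₁ (x * Algebra.norm E₁ (d i : L)) = 0)
    rw [Finset.card_univ, Fintype.card_fin] at this
    exact this
  have hw := congrArg (Nat.cast : ℕ → ℚ) hsplit
  rw [Nat.cast_add] at hw
  rw [eq_sub_of_add_eq' hw, hM, hn]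
  have hq0 : (q : ℚ) ≠ 0 := by positivity
  have hne : ∀ s, s ≠ 0 → (q : ℚ) ^ (2 * s) - 1 ≠ 0 := fun s hs => by
    have : (1 : ℚ) < (q : ℚ) ^ (2 * s) := one_lt_pow₀ (by exact_mod_cast hq1) (by omega)
    linarith
  have h10 := hne s₁ hs₁0
  have h20 := hne s₂ hs₂0
  have hpred : (q : ℚ) ^ (2 * s₂ - 1) = q ^ (2 * s₂) / q := by
    rw [eq_div_iff hq0, pow_sub_one_mul (by omega)]
  have ha : (q : ℚ) ^ s₁ ≠ 0 := pow_ne_zero _ hq0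
  rw [hpred]
  rw [mul_comm 2 s₁, mul_comm 2 s₂, pow_mul, pow_mul] at *
  simp only [pow_add]
  generalize (q : ℚ) ^ s₁ = a at *
  generalize (q : ℚ) ^ s₂ = b at *
  split_ifs
  · field_simp
    ring
  · field_simp
    ring

theorem card_ne_zero_and_pow_eq [Finite E₁] (hq : Nat.card F = q)
    (hs₁ : Module.finrank F E₁ = 2 * s₁) (hJ₁ : (q + 1) * J₁ = q ^ (2 * s₁) - 1) (k : ℕ) :
    Nat.card {x : E₁ // x ≠ 0 ∧ x ^ J₁ = (-1) ^ k} = J₁ ∧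
      Nat.card {x : E₁ // x ≠ 0 ∧ ¬ x ^ J₁ = (-1) ^ k} = q * J₁ := by
  have hneg : (-1 : E₁ˣ) ^ (q + 1) = 1 := by
    have := neg_one_pow_card_pow (E := E₁) hq 1
    rw [pow_one] at this
    ext
    simp [pow_succ, this]
  have hcard : Nat.card E₁ˣ = J₁ * (q + 1) := by
    rw [natCard_units_eq hq hs₁, ← hJ₁, mul_comm]
  have h1 : Nat.card {u : E₁ˣ // u ^ J₁ = (-1) ^ k} = J₁ :=
    card_pow_eq_of_isCyclic hcard (by rw [pow_right_comm, hneg, one_pow])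
  classical
  have h2 := Nat.card_congr (Equiv.sumCompl fun u : E₁ˣ => u ^ J₁ = (-1) ^ k)
  rw [Nat.card_sum, h1, hcard] at h2
  have hunit : ∀ u : E₁ˣ, (u : E₁) ^ J₁ = (-1) ^ k ↔ u ^ J₁ = (-1) ^ k := fun u => by
    rw [Units.ext_iff]; simp
  rw [card_subtype_eq_card_units (E := E₁) _ (by simp),
    card_subtype_eq_card_units (E := E₁) (fun x => x ≠ 0 ∧ ¬ x ^ J₁ = (-1) ^ k) (by simp)]
  simp only [ne_eq, Units.ne_zero, not_false_eq_true, true_and, hunit]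
  refine ⟨h1, ?_⟩
  linarith

/-- This makes both weights positive. For s = t = 1 it degenerates to an equality, which is why (m₁,
m₂) = (2, 2) is excluded. -/
theorem mul_pow_lt_pow_sub_one {q : ℚ} (hq : 1 < q) {s t : ℕ} (hs : s ≠ 0) (ht : t ≠ 0)
    (hst : (s, t) ≠ (1, 1)) : (q - 1) * (q ^ t / q ^ s) < q ^ (2 * t) / q - 1 := by
  have hq0 : 0 < q := by linarith
  have ha : 0 < q ^ s := by positivity
  rw [← mul_div_assoc, div_lt_iff₀ ha]
  by_cases ht1 : t = 1
  · subst ht1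
    have hs2 : 1 < s := by
      have : s ≠ 1 := fun h => hst (by rw [h])
      omega
    have : q ^ 1 < q ^ s := pow_lt_pow_right₀ hq hs2
    rw [show q ^ (2 * 1) / q = q by field_simp]
    exact mul_lt_mul_of_pos_left this (by linarith)
  · obtain ⟨k, rfl⟩ : ∃ k, t = k + 2 := ⟨t - 2, by omega⟩
    have h1 : q ≤ q ^ s := le_self_pow₀ hq.le hs
    have h2 : 1 ≤ q ^ k := one_le_pow₀ hq.le
    have e : q ^ (2 * (k + 2)) / q = q ^ (k + 2) * q * q ^ k := by
      field_simp; ring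
    rw [e]
    have hb : 1 < q ^ (k + 2) := one_lt_pow₀ hq (by omega)
    have h3 : q ^ (k + 2) * q - 1 ≤ q ^ (k + 2) * q * q ^ k - 1 := by
      have := le_mul_of_one_le_right (a := q ^ (k + 2) * q) (by positivity) h2
      linarith
    have h4 : (q - 1) * q ^ (k + 2) < q ^ (k + 2) * q - 1 := by linarith
    have h5 : 0 < (q - 1) * q ^ (k + 2) := mul_pos (by linarith) (by positivity)
    nlinarith

end Weights

end TraceNormCode

/-! ### The main theorem -/

open TraceNormCode in
/-- `F ⊆ E₁, E₂ ⊆ L` are finite fields with `q`, `q ^ m₁`, `q ^ m₂` and `q ^ m` elements, and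
`d` enumerates the defining set with `a = 0`. The divisions of exponents by `2` are exact. -/
theorem theorem4p2 {F E₁ E₂ L : Type*} [Field F] [Field E₁] [Field E₂] [Field L] [Finite L]
    [Algebra F E₁] [Algebra F E₂] [Algebra F L] [Algebra E₁ L] [Algebra E₂ L]
    [IsScalarTower F E₁ L] [IsScalarTower F E₂ L]
    (q m m₁ m₂ : ℕ) (hq : Nat.card F = q)
    (hm : Module.finrank F L = m)
    (hm₁ : Module.finrank F E₁ = m₁) (hm₂ : Module.finrank F E₂ = m₂)
    (hm₂_gt : 1 < m₂) (he : Nat.gcd m₁ m₂ = 2) (hne : (m₁, m₂) ≠ (2, 2))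
    (n : ℕ) (d : Fin n ≃ TraceNormCode.definingSet E₂ L (0 : F)) :
    (n : ℚ) = ((q : ℚ) ^ m - 1) / ((q : ℚ) ^ m₂ - 1) * ((q : ℚ) ^ (m₂ - 1) - 1) ∧
    Module.finrank F (TraceNormCode.code F E₁ fun i => (d i : L)) = m₁ ∧
    TraceNormCode.IsWeight 2 (TraceNormCode.code F E₁ fun i => (d i : L)) ∧
    ∃ w₁ w₂ f₁ f₂ : ℕ,
      0 < w₁ ∧ 0 < w₂ ∧ w₁ ≠ w₂ ∧
      (w₁ : ℚ) = (q : ℚ) ^ (m₁ - 1) * ((q : ℚ) - 1) * ((q : ℚ) ^ m - 1) *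
          ((q : ℚ) ^ (m₂ - 1) - 1 - (-1 : ℚ) ^ ((m₁ + m₂) / 2) * ((q : ℚ) - 1) *
            (q : ℚ) ^ (((m₂ : ℤ) - (m₁ : ℤ)) / 2)) /
          (((q : ℚ) ^ m₁ - 1) * ((q : ℚ) ^ m₂ - 1)) ∧
      (f₁ : ℚ) = ((q : ℚ) ^ m₁ - 1) / ((q : ℚ) + 1) ∧
      (w₂ : ℚ) = (q : ℚ) ^ (m₁ - 1) * ((q : ℚ) - 1) * ((q : ℚ) ^ m - 1) *
          ((q : ℚ) ^ (m₂ - 1) - 1 - (-1 : ℚ) ^ ((m₁ + m₂) / 2 + 1) * ((q : ℚ) - 1) *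
            (q : ℚ) ^ (((m₂ : ℤ) - (m₁ : ℤ)) / 2 - 1)) /
          (((q : ℚ) ^ m₁ - 1) * ((q : ℚ) ^ m₂ - 1)) ∧
      (f₂ : ℚ) = (q : ℚ) * ((q : ℚ) ^ m₁ - 1) / ((q : ℚ) + 1) ∧
      TraceNormCode.weightEnumerator (TraceNormCode.code F E₁ fun i => (d i : L)) =
        1 + Polynomial.monomial w₁ f₁ + Polynomial.monomial w₂ f₂ := by
  classical
  have := Finite.of_injective _ (algebraMap E₁ L).injective
  have := Finite.of_injective _ (algebraMap E₂ L).injective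
  have := Module.Finite.of_finite (R := F) (M := E₁)
  have := Module.Finite.of_finite (R := F) (M := E₂)
  have hq1 := one_lt_natCard_base E₁ hq
  obtain ⟨s₁, rfl⟩ : 2 ∣ m₁ := he ▸ Nat.gcd_dvd_left m₁ m₂
  obtain ⟨s₂, rfl⟩ : 2 ∣ m₂ := he ▸ Nat.gcd_dvd_right (2 * s₁) m₂
  have hs₁0 : s₁ ≠ 0 := by
    have := Module.finrank_pos (R := F) (M := E₁)
    omega
  have hs₂0 : s₂ ≠ 0 := by omega
  have hs : (s₁, s₂) ≠ (1, 1) := by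
    rintro h
    obtain ⟨rfl, rfl⟩ := Prod.mk.inj h
    exact hne rfl
  have hcast : ∀ k, ((q ^ k - 1 : ℕ) : ℚ) = (q : ℚ) ^ k - 1 := fun k => by
    rw [Nat.cast_sub (Nat.one_le_pow _ _ (by omega))]; simp
  have hL : (Nat.card Lˣ : ℚ) = (q : ℚ) ^ m - 1 := by rw [natCard_units_eq hq hm, hcast]
  have hq1' : (1 : ℚ) < q := by exact_mod_cast hq1
  have hq0 : (q : ℚ) ≠ 0 := by positivity
  have hpos : ∀ s, s ≠ 0 → 0 < (q : ℚ) ^ (2 * s) - 1 := fun s hs =>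
    sub_pos.2 (one_lt_pow₀ hq1' (by omega))
  have hpred : ∀ s, s ≠ 0 → (q : ℚ) ^ (2 * s - 1) = q ^ (2 * s) / q := fun s hs => by
    rw [eq_div_iff hq0, pow_sub_one_mul (by omega)]
  obtain ⟨J₁, hJ₁⟩ : q + 1 ∣ q ^ (2 * s₁) - 1 := by
    refine dvd_trans ⟨q - 1, by simpa using Nat.sq_sub_sq q 1⟩
      (by rw [pow_mul]; simpa using Nat.sub_dvd_pow_sub_pow (q ^ 2) 1 s₁)
  have hJ₁q : ((q : ℚ) + 1) * J₁ = q ^ (2 * s₁) - 1 := by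
    rw [← hcast, hJ₁]; push_cast; ring
  have hJ₁0 : J₁ ≠ 0 := by
    rintro rfl
    have := hpos s₁ hs₁0
    rw [← hJ₁q] at this
    simp at this
  obtain ⟨hf₁, hf₂⟩ := card_ne_zero_and_pow_eq hq hm₁ hJ₁.symm (s₁ + s₂)
  have hwt := fun (x : E₁) (hx : x ≠ 0) => hammingNorm_codeword hq hm₁ hm₂ he hJ₁.symm d hx
  set φ := codeword F E₁ (fun i => (d i : L)) with hφdef
  set P : E₁ → Prop := fun x => x ^ J₁ = (-1) ^ (s₁ + s₂) with hP
  have hX := mul_pow_lt_pow_sub_one hq1' hs₁0 hs₂0 hs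
  set X : ℚ := (q : ℚ) ^ s₂ / q ^ s₁ with hXdef
  set ε : ℚ := (-1) ^ (s₁ + s₂) with hε
  have hε' : ε = 1 ∨ ε = -1 := neg_one_pow_eq_or ℚ _
  have hX0 : 0 < X := by positivity
  set T : ℚ := (q : ℚ) ^ (2 * s₂) / q - 1 with hT
  set K : ℚ := Nat.card Lˣ / (((q : ℚ) ^ (2 * s₁) - 1) * ((q : ℚ) ^ (2 * s₂) - 1)) *
      ((q : ℚ) ^ (2 * s₁) / q * (q - 1)) with hK
  have hK0 : 0 < K := by
    have h1 := hpos s₁ hs₁0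
    have h2 := hpos s₂ hs₂0
    have h3 : 0 < (Nat.card Lˣ : ℚ) := by exact_mod_cast Nat.card_pos
    have h4 : 0 < (q : ℚ) - 1 := by linarith
    positivity
  have hwP : ∀ x, x ≠ 0 → P x → (hammingNorm (φ x) : ℚ) = K * (T - ε * (q - 1) * X) := by
    intro x hx hPx
    rw [hwt x hx, if_pos hPx]
  have hwN : ∀ x, x ≠ 0 → ¬ P x → (hammingNorm (φ x) : ℚ) = K * (T - ε * (q - 1) * -(X / q)) := by
    intro x hx hPx
    rw [hwt x hx, if_neg hPx]
  -- The deviations from T are ±(q - 1)X and ±(q - 1)X/q, so the single bound (q - 1)X < T gives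
  -- positivity for either sign ε.
  have hXq : X / q ≤ X := div_le_self hX0.le hq1'.le
  have hXq0 : 0 < X / q := by positivity
  have hpos₁ : 0 < K * (T - ε * (q - 1) * X) := by
    refine mul_pos hK0 ?_
    rcases hε' with h | h <;> rw [h] <;> nlinarith
  have hpos₂ : 0 < K * (T - ε * (q - 1) * -(X / q)) := by
    refine mul_pos hK0 ?_
    rcases hε' with h | h <;> rw [h] <;> nlinarith
  have hdiff : K * (T - ε * (q - 1) * X) ≠ K * (T - ε * (q - 1) * -(X / q)) := by
    intro h
    have h1 := mul_left_cancel₀ hK0.ne' h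
    have h2 : 0 < (q - 1) * (X + X / q) := mul_pos (by linarith) (by linarith)
    rcases hε' with h | h <;> rw [h] at h1 <;> linarith
  -- Positive weights leave no nonzero x in the kernel.
  have hinj : Function.Injective φ := by
    rw [injective_iff_map_eq_zero]
    intro x hx
    by_contra hx0
    have h0 : (hammingNorm (φ x) : ℚ) = 0 := by rw [hx]; simp
    by_cases hPx : P x
    · exact hpos₁.ne' ((hwP x hx0 hPx).symm.trans h0)
    · exact hpos₂.ne' ((hwN x hx0 hPx).symm.trans h0)
  -- Representatives of the two classes supply the weights as natural numbers; the formulas are only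
  -- rational.
  obtain ⟨⟨x₁, hx₁, hPx₁⟩⟩ : Nonempty {x : E₁ // x ≠ 0 ∧ P x} :=
    (Nat.card_ne_zero.1 (hf₁.trans_ne hJ₁0)).1
  obtain ⟨⟨x₂, hx₂, hPx₂⟩⟩ : Nonempty {x : E₁ // x ≠ 0 ∧ ¬ P x} :=
    (Nat.card_ne_zero.1 (hf₂.trans_ne (by positivity))).1
  have hw₁ := hwP x₁ hx₁ hPx₁
  have hw₂ := hwN x₂ hx₂ hPx₂
  have h₁ : ∀ x, x ≠ 0 → P x → hammingNorm (φ x) = hammingNorm (φ x₁) := fun x hx hPx => by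
    exact_mod_cast (hwP x hx hPx).trans hw₁.symm
  have h₂ : ∀ x, x ≠ 0 → ¬ P x → hammingNorm (φ x) = hammingNorm (φ x₂) := fun x hx hPx => by
    exact_mod_cast (hwN x hx hPx).trans hw₂.symm
  have hle : ∀ x, hammingNorm (φ x) ≤ n := fun x => by
    simpa using hammingNorm_le_card_fintype (x := φ x)
  have hw₁0 : 0 < hammingNorm (φ x₁) := by rw [← hw₁] at hpos₁; exact_mod_cast hpos₁
  have hw₂0 : 0 < hammingNorm (φ x₂) := by rw [← hw₂] at hpos₂; exact_mod_cast hpos₂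
  have hw₁₂ : hammingNorm (φ x₁) ≠ hammingNorm (φ x₂) := fun h =>
    hdiff (by rw [← hw₁, ← hw₂, h])
  have hexp₁ : (2 * s₁ + 2 * s₂) / 2 = s₁ + s₂ := by omega
  have hexp₂ : (((2 * s₂ : ℕ) : ℤ) - ((2 * s₁ : ℕ) : ℤ)) / 2 = (s₂ : ℤ) - s₁ := by omega
  have hzpow : (q : ℚ) ^ ((s₂ : ℤ) - s₁) = X := by
    rw [zpow_sub₀ hq0, zpow_natCast, zpow_natCast]
  have hzpow' : (q : ℚ) ^ ((s₂ : ℤ) - s₁ - 1) = X / q := by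
    rw [zpow_sub_one₀ hq0, hzpow, div_eq_mul_inv]
  refine ⟨?_, ?_, isWeight_two_range φ hinj P h₁ h₂ (hle _) (hle _) hw₁0 hw₂0 hw₁₂
    (hf₁.trans_ne hJ₁0) (hf₂.trans_ne (by positivity)), hammingNorm (φ x₁), hammingNorm (φ x₂),
    J₁, q * J₁, hw₁0, hw₂0, hw₁₂, ?_, ?_, ?_, ?_, ?_⟩
  · have := length_eq hq (k := 2 * s₂ - 1) (by omega) d
    rwa [hL, show 2 * s₂ - 1 + 1 = 2 * s₂ by omega] at this
  · exact (LinearMap.finrank_range_of_inj hinj).trans hm₁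
  · rw [hw₁, hexp₁, hexp₂, hzpow, hpred _ hs₁0, hpred _ hs₂0, hK, ← hL]
    ring
  · rw [eq_div_iff (by positivity), ← hJ₁q]; ring
  · rw [hw₂, hexp₁, hexp₂, hzpow', hpred _ hs₁0, hpred _ hs₂0, hK, ← hL, pow_succ]
    ring
  · rw [eq_div_iff (by positivity), ← hJ₁q]; push_cast; ring
  · have := weightEnumerator_range_eq φ hinj P h₁ h₂ (hle _) (hle _)
    rw [hf₁, hf₂] at this
    exact this
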